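/- Let $\mathcal H$ be a separable real Hilbert space with its Borel $\sigma$-algebra, and let $\mathcal P_1(\mathcal H)$ be the set of Borel probability measures $\nu$ on $\mathcal H$ with finite first moment, i.e. $\int \|y-x_0\|\,\mathrm d\nu(y)<\infty$ for some $x_0\in\mathcal H$. For $\mu,\nu\in\mathcal P_1(\mathcal H)$ put $$W_1(\mu,\nu)=\sup\Big\{\Big|\int h\,\mathrm d\mu-\int h\,\mathrm d\nu\Big| : h:\mathcal H\to\mathbb R \text{ is } 1\text{-Lipschitz}\Big\}.$$ Let $m=(m_x)_{x\in\mathcal H}$ be a random walk on $\mathcal H$, i.e. $m_x\in\mathcal P_1(\mathcal H)$ for every $x\in\mathcal H$ and $x\mapsto m_x(C)$ is measurable for every Borel set $C\subseteq\mathcal H$. Suppose that there is $0<\tau<1$ such that $$W_1(m_x,m_y)\le\tau\,\|x-y\|\qquad\text{for all }x,y\in\mathcal H$$ (so that the Ollivier–Ricci curvature $\kappa_m(x,y)=1-W_1(m_x,m_y)/\|x-y\|$ satisfies $\kappa_m(x,y)\ge 1-\tau>0$ for all $x\neq y$). Then there is exactly one measure $\upsilon\in\mathcal P_1(\mathcal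 H)$ that is invariant with respect to $m$, i.e. such that $$\upsilon(C)=\int_{\mathcal H} m_x(C)\,\mathrm d\upsilon(x)\qquad\text{for every Borel set }C\subseteq\mathcal H.$$ -/

import Mathlib

open MeasureTheory ProbabilityTheory
open scoped NNReal ENNReal

/-- `μ` belongs to `P₁(X)`: it is a probability measure with finite first-order moment, that is,
`∫ d(y, x₀) dμ(y) < ∞` for some base point `x₀`. -/
structure IsProbWithFirstMoment {X : Type*} [MetricSpace X] [MeasurableSpace X]
    (μ : Measure X) : Prop where
  isProbabilityMeasure : IsProbabilityMeasure μ
  finite_first_moment : ∃ x₀ : X, ∫⁻ y, edist y x₀ ∂μ < ∞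

/-- A random walk on `X`: a family `(m_x)` depending measurably on `x` (this is what a `Kernel`
is) of probability measures on `X` with finite first-order moment. -/
def IsRandomWalk {X : Type*} [MetricSpace X] [MeasurableSpace X] (m : Kernel X X) : Prop :=
  ∀ x : X, IsProbWithFirstMoment (m x)

/-- The `W₁`-Wasserstein distance: the supremum of `|∫ h dμ - ∫ h dν|` over all `1`-Lipschitz
functions `h : X → ℝ`, as an extended nonnegative number. It is meant for `μ` and `ν` in `P₁(X)`,
for which every such `h` is integrable. -/
noncomputable def wassersteinOne {X : Type*} [MetricSpace X] [MeasurableSpace X]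
    (μ ν : Measure X) : ℝ≥0∞ :=
  ⨆ (h : X → ℝ) (_ : LipschitzWith 1 h), ENNReal.ofReal |∫ y, h y ∂μ - ∫ y, h y ∂ν|

open Filter Topology

section FirstMoment

variable {X : Type*} [MetricSpace X] [MeasurableSpace X]

lemma IsProbWithFirstMoment.integrable_of_lipschitzWith [BorelSpace X] {μ : Measure X}
    (hμ : IsProbWithFirstMoment μ) {L : ℝ≥0} {h : X → ℝ} (hh : LipschitzWith L h) :
    Integrable h μ := by
  have := hμ.isProbabilityMeasure
  obtain ⟨x₀, hx₀⟩ := hμ.finite_first_moment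
  have hd : Integrable (fun y ↦ dist y x₀) μ := by
    refine ⟨(continuous_id.dist continuous_const).measurable.aestronglyMeasurable, ?_⟩
    simpa [HasFiniteIntegral, Real.enorm_eq_ofReal, edist_dist] using hx₀
  refine ((integrable_const ‖h x₀‖).add (hd.const_mul (L : ℝ))).mono'
    hh.continuous.measurable.aestronglyMeasurable (ae_of_all _ fun y ↦ ?_)
  have h1 : ‖h y - h x₀‖ ≤ L * dist y x₀ := by
    rw [← dist_eq_norm]; exact hh.dist_le_mul y x₀
  have h2 := norm_sub_norm_le (h y) (h x₀)
  simp only [Pi.add_apply]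
  linarith

lemma IsProbWithFirstMoment.of_integrable_dist {μ : Measure X} [IsProbabilityMeasure μ] {x₀ : X}
    (hd : Integrable (fun y ↦ dist y x₀) μ) : IsProbWithFirstMoment μ := by
  refine ⟨‹_›, x₀, ?_⟩
  simpa [HasFiniteIntegral, Real.enorm_eq_ofReal, edist_dist] using hd.2

lemma isProbWithFirstMoment_dirac [BorelSpace X] (x : X) :
    IsProbWithFirstMoment (Measure.dirac x) :=
  ⟨inferInstance, x, by simp [lintegral_dirac]⟩

/-- Integrals of an `L`-Lipschitz function against two measures differ by at most `L` times their
Wasserstein distance. -/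
lemma ofReal_abs_integral_sub_le_mul_wassersteinOne {μ ν : Measure X}
    [IsProbabilityMeasure μ] [IsProbabilityMeasure ν] {L : ℝ≥0} {h : X → ℝ}
    (hh : LipschitzWith L h) :
    ENNReal.ofReal |∫ y, h y ∂μ - ∫ y, h y ∂ν| ≤ L * wassersteinOne μ ν := by
  obtain ⟨x₀⟩ : Nonempty X := nonempty_of_isProbabilityMeasure μ
  rcases eq_or_ne L 0 with rfl | hL
  · have hc : h = fun _ ↦ h x₀ := funext fun y ↦ by
      simpa using hh.dist_le_mul y x₀
    rw [hc]
    simp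
  · have hL' : (0 : ℝ) < L := by positivity
    have hscale : LipschitzWith 1 (fun y ↦ (L : ℝ)⁻¹ * h y) := by
      refine LipschitzWith.of_dist_le_mul fun x y ↦ ?_
      rw [Real.dist_eq, ← mul_sub, abs_mul, abs_of_pos (inv_pos.2 hL'), ← Real.dist_eq,
        inv_mul_le_iff₀ hL']
      simpa using hh.dist_le_mul x y
    have hle : ENNReal.ofReal |∫ y, (L : ℝ)⁻¹ * h y ∂μ - ∫ y, (L : ℝ)⁻¹ * h y ∂ν|
        ≤ wassersteinOne μ ν := le_iSup₂ (α := ℝ≥0∞) (fun y ↦ (L : ℝ)⁻¹ * h y) hscale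
    calc ENNReal.ofReal |∫ y, h y ∂μ - ∫ y, h y ∂ν|
        = L * ENNReal.ofReal |∫ y, (L : ℝ)⁻¹ * h y ∂μ - ∫ y, (L : ℝ)⁻¹ * h y ∂ν| := by
          rw [integral_const_mul, integral_const_mul, ← mul_sub, abs_mul,
            abs_of_pos (inv_pos.2 hL'), ← ENNReal.ofReal_coe_nnreal,
            ← ENNReal.ofReal_mul hL'.le, mul_inv_cancel_left₀ hL'.ne']
      _ ≤ L * wassersteinOne μ ν := by gcongr

lemma IsProbWithFirstMoment.abs_integral_sub_apply_le [BorelSpace X] {μ : Measure X}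
    (hμ : IsProbWithFirstMoment μ) {L : ℝ≥0} {h : X → ℝ} (hh : LipschitzWith L h) (x₀ : X) :
    |∫ y, h y ∂μ - h x₀| ≤ L * ∫ y, dist y x₀ ∂μ := by
  have := hμ.isProbabilityMeasure
  have hd : Integrable (fun y ↦ dist y x₀) μ :=
    hμ.integrable_of_lipschitzWith (LipschitzWith.dist_left x₀)
  have hi := hμ.integrable_of_lipschitzWith hh
  have heq : ∫ y, h y ∂μ - h x₀ = ∫ y, (h y - h x₀) ∂μ := by
    rw [integral_sub hi (integrable_const _)]; simp
  rw [heq, ← integral_const_mul, ← Real.norm_eq_abs]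
  refine norm_integral_le_of_norm_le (hd.const_mul _) (ae_of_all _ fun y ↦ ?_)
  rw [← dist_eq_norm]
  exact hh.dist_le_mul y x₀

/-- Two finite Borel measures that integrate all bounded Lipschitz functions alike are equal. -/
lemma ext_of_forall_integral_eq_of_bounded_lipschitzWith [BorelSpace X] {μ ν : Measure X}
    [IsFiniteMeasure μ] [IsFiniteMeasure ν]
    (H : ∀ (L : ℝ≥0) (h : X → ℝ), LipschitzWith L h → (∀ x, ‖h x‖ ≤ 1) →
      ∫ y, h y ∂μ = ∫ y, h y ∂ν) : μ = ν := by
  have hδ : ∀ n : ℕ, (0 : ℝ) < 1 / ((n : ℝ) + 1) := fun n ↦ by positivity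
  have key : ∀ F : Set X, IsClosed F → μ F = ν F := fun F hF ↦ by
    refine tendsto_nhds_unique (tendsto_lintegral_thickenedIndicator_of_isClosed μ hF hδ
      tendsto_one_div_add_atTop_nhds_zero_nat) ?_
    refine (tendsto_lintegral_thickenedIndicator_of_isClosed ν hF hδ
      tendsto_one_div_add_atTop_nhds_zero_nat).congr fun n ↦ ?_
    have hlip := NNReal.isometry_coe.lipschitz.comp (lipschitzWith_thickenedIndicator (hδ n) F)
    have hint := H _ _ hlip fun x ↦ by
      simpa using thickenedIndicator_le_one (hδ n) F x
    have hconv : ∀ ρ : Measure X, IsFiniteMeasure ρ →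
        ∫⁻ x, (thickenedIndicator (hδ n) F x : ℝ≥0∞) ∂ρ
          = ENNReal.ofReal (∫ x, (thickenedIndicator (hδ n) F x : ℝ) ∂ρ) := fun ρ _ ↦ by
      rw [ofReal_integral_eq_lintegral_ofReal]
      · simp
      · exact Integrable.of_bound
          hlip.continuous.measurable.aestronglyMeasurable 1
          (ae_of_all _ fun x ↦ by simpa using thickenedIndicator_le_one (hδ n) F x)
      · exact ae_of_all _ fun x ↦ NNReal.coe_nonneg _
    rw [hconv μ inferInstance, hconv ν inferInstance]
    exact congrArg ENNReal.ofReal hint.symm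
  refine ext_of_generate_finite _ (BorelSpace.measurable_eq.trans borel_eq_generateFrom_isClosed)
    isPiSystem_isClosed (fun F hF ↦ key F hF) (key _ isClosed_univ)

end FirstMoment

section Tightness

variable {X : Type*} [MetricSpace X] [CompleteSpace X] [MeasurableSpace X]

/-- A set of measures on a complete space is tight if thickenings of compact sets capture nearly
all of the mass, uniformly in the measure. -/
lemma isTightMeasureSet_of_forall_exists_cthickening {S : Set (Measure X)}
    (H : ∀ ε : ℝ≥0∞, 0 < ε → ∀ δ : ℝ, 0 < δ →
      ∃ K, IsCompact K ∧ ∀ μ ∈ S, μ (Metric.cthickening δ K)ᶜ ≤ ε) :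
    IsTightMeasureSet S := by
  rw [isTightMeasureSet_iff_exists_isCompact_measure_compl_le]
  intro ε hε
  obtain ⟨η, hη, hηε⟩ := ENNReal.exists_pos_sum_of_countable' hε.ne' ℕ
  choose K hK hKS using fun n : ℕ ↦ H (η n) (hη n) (1 / ((n : ℝ) + 1)) (by positivity)
  refine ⟨⋂ n : ℕ, Metric.cthickening (1 / ((n : ℝ) + 1)) (K n), ?_, fun μ hμ ↦ ?_⟩
  · refine TotallyBounded.isCompact_of_isClosed ?_
      (isClosed_iInter fun n ↦ Metric.isClosed_cthickening)
    refine Metric.totallyBounded_iff.2 fun r hr ↦ ?_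
    obtain ⟨n, hn⟩ := exists_nat_one_div_lt (half_pos hr)
    obtain ⟨t, ht, hcov⟩ := Metric.totallyBounded_iff.1 (hK n).totallyBounded (r / 2) (half_pos hr)
    refine ⟨t, ht, fun x hx ↦ ?_⟩
    have hx' := Set.mem_iInter.1 hx n
    rw [(hK n).cthickening_eq_biUnion_closedBall (by positivity)] at hx'
    obtain ⟨y, hy, hxy⟩ := Set.mem_iUnion₂.1 hx'
    obtain ⟨z, hz, hyz⟩ := Set.mem_iUnion₂.1 (hcov hy)
    refine Set.mem_iUnion₂.2 ⟨z, hz, ?_⟩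
    rw [Metric.mem_closedBall] at hxy
    rw [Metric.mem_ball] at hyz ⊢
    linarith [dist_triangle x y z]
  · rw [Set.compl_iInter]
    exact (measure_iUnion_le _).trans ((ENNReal.tsum_le_tsum fun n ↦ hKS n μ hμ).trans hηε.le)

/-- A sequence of probability measures that is Cauchy for the `1`-Wasserstein distance, tested on
bounded Lipschitz functions, is tight. -/
lemma isTightMeasureSet_range_of_cauchy [SecondCountableTopology X] [BorelSpace X]
    (μ : ℕ → Measure X) [∀ n, IsProbabilityMeasure (μ n)]
    (H : ∀ (L : ℝ≥0) (ε : ℝ), 0 < ε → ∃ N, ∀ n ≥ N, ∀ h : X → ℝ, LipschitzWith L h →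
      |∫ y, h y ∂μ n - ∫ y, h y ∂μ N| ≤ ε) :
    IsTightMeasureSet (Set.range μ) := by
  refine isTightMeasureSet_of_forall_exists_cthickening fun ε' hε' δ hδ ↦ ?_
  obtain ⟨ε, hε, hεε'⟩ : ∃ ε : ℝ, 0 < ε ∧ ENNReal.ofReal (2 * ε) ≤ ε' := by
    obtain ⟨a, ha, ha'⟩ := ENNReal.lt_iff_exists_nnreal_btwn.1 hε'
    refine ⟨a / 2, half_pos (by simpa using ha), ?_⟩
    rw [mul_div_cancel₀ _ two_ne_zero, ENNReal.ofReal_coe_nnreal]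
    exact ha'.le
  obtain ⟨N, hN⟩ := H δ.toNNReal⁻¹ ε hε
  choose K hK hKμ using fun n ↦ isTightMeasureSet_iff_exists_isCompact_measure_compl_le.1
    (isTightMeasureSet_singleton (μ := μ n)) (ENNReal.ofReal ε) (by simpa using hε)
  have hC : IsCompact (⋃ n ∈ Finset.range (N + 1), K n) :=
    (Finset.range (N + 1)).isCompact_biUnion fun n _ ↦ hK n
  set C := ⋃ n ∈ Finset.range (N + 1), K n
  have hCμ : ∀ n ≤ N, μ n Cᶜ ≤ ENNReal.ofReal ε := fun n hn ↦
    (measure_mono (Set.compl_subset_compl.2 (Set.subset_biUnion_of_mem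
      (u := K) (Finset.mem_coe.2 (Finset.mem_range.2 (Nat.lt_succ_of_le hn)))))).trans
      (hKμ n _ rfl)
  refine ⟨C, hC, ?_⟩
  rintro _ ⟨n, rfl⟩
  rcases le_total n N with hn | hn
  · refine (measure_mono (Set.compl_subset_compl.2 (Metric.self_subset_cthickening C))).trans
      ((hCμ n hn).trans (le_trans ?_ hεε'))
    exact ENNReal.ofReal_le_ofReal (by linarith)
  · have hlip := NNReal.isometry_coe.lipschitz.comp (lipschitzWith_thickenedIndicator hδ C)
    rw [one_mul] at hlip
    have hdiff := hN n hn _ hlip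
    set f : X → ℝ := NNReal.toReal ∘ thickenedIndicator hδ C with hf
    have hf1 : ∀ x, f x ≤ 1 := fun x ↦ by simpa [f] using thickenedIndicator_le_one hδ C x
    have hf0 : ∀ x, 0 ≤ f x := fun x ↦ NNReal.coe_nonneg _
    have hfi : ∀ k, Integrable f (μ k) := fun k ↦
      Integrable.of_bound hlip.continuous.measurable.aestronglyMeasurable 1
        (ae_of_all _ fun x ↦ by rw [Real.norm_of_nonneg (hf0 x)]; exact hf1 x)
    have hmt : MeasurableSet (Metric.cthickening δ C) := Metric.isClosed_cthickening.measurableSet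
    have lower : (μ N).real C ≤ ∫ y, f y ∂μ N := by
      rw [← integral_indicator_one hC.measurableSet]
      refine integral_mono ((integrable_const 1).indicator hC.measurableSet) (hfi N) fun x ↦ ?_
      by_cases hx : x ∈ C
      · simp [hx, f, thickenedIndicator_one hδ C hx]
      · simpa [hx] using hf0 x
    have upper : ∫ y, f y ∂μ n ≤ (μ n).real (Metric.cthickening δ C) := by
      rw [← integral_indicator_one hmt]
      refine integral_mono (hfi n) ((integrable_const 1).indicator hmt) fun x ↦ ?_
      by_cases hx : x ∈ Metric.cthickening δ C
      · simpa [hx] using hf1 x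
      · have hx' : x ∉ Metric.thickening δ C := fun h ↦ hx (Metric.thickening_subset_cthickening _ _ h)
        simp [hx, f, thickenedIndicator_zero hδ C hx']
    have hCN : (μ N).real Cᶜ ≤ ε := ENNReal.toReal_le_of_le_ofReal hε.le (hCμ N le_rfl)
    rw [probReal_compl_eq_one_sub hC.measurableSet] at hCN
    have hfin : (μ n).real (Metric.cthickening δ C)ᶜ ≤ 2 * ε := by
      rw [probReal_compl_eq_one_sub hmt]
      linarith [(abs_le.1 hdiff).1]
    refine le_trans ?_ hεε'
    rw [← ofReal_measureReal]
    exact ENNReal.ofReal_le_ofReal hfin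

end Tightness

section Contraction

variable {X : Type*} [MeasurableSpace X] {m : Kernel X X}

lemma integral_bind_kernel {μ : Measure X} {h : X → ℝ} (hi : Integrable h (μ.bind m)) :
    ∫ y, h y ∂μ.bind m = ∫ x, ∫ y, h y ∂m x ∂μ := by
  rw [Measure.comp_eq_comp_const_apply] at hi ⊢
  simpa using ProbabilityTheory.Kernel.integral_comp hi

variable [MetricSpace X] {r : ℝ≥0}

lemma lipschitzWith_integral_kernel (hm : IsRandomWalk m)
    (hLip : ∀ x y, wassersteinOne (m x) (m y) ≤ r * edist x y)
    {L : ℝ≥0} {h : X → ℝ} (hh : LipschitzWith L h) :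
    LipschitzWith (r * L) fun x ↦ ∫ y, h y ∂m x := fun x y ↦ by
  have := (hm x).isProbabilityMeasure
  have := (hm y).isProbabilityMeasure
  rw [edist_dist, Real.dist_eq]
  refine (ofReal_abs_integral_sub_le_mul_wassersteinOne hh).trans ?_
  calc (L : ℝ≥0∞) * wassersteinOne (m x) (m y) ≤ L * (r * edist x y) := by gcongr; exact hLip x y
    _ = ↑(r * L) * edist x y := by push_cast; ring

lemma IsRandomWalk.isMarkovKernel (hm : IsRandomWalk m) : IsMarkovKernel m :=
  ⟨fun x ↦ (hm x).isProbabilityMeasure⟩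

variable [BorelSpace X]

lemma IsProbWithFirstMoment.bind_kernel (hm : IsRandomWalk m)
    (hLip : ∀ x y, wassersteinOne (m x) (m y) ≤ r * edist x y) {μ : Measure X}
    (hμ : IsProbWithFirstMoment μ) : IsProbWithFirstMoment (μ.bind m) := by
  have := hμ.isProbabilityMeasure
  have := hm.isMarkovKernel
  obtain ⟨x₀⟩ : Nonempty X := nonempty_of_isProbabilityMeasure μ
  have hd : LipschitzWith 1 fun y ↦ dist y x₀ := LipschitzWith.dist_left x₀
  refine .of_integrable_dist (x₀ := x₀) ((Measure.integrable_comp_iff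
    hd.continuous.measurable.aestronglyMeasurable).2
      ⟨ae_of_all _ fun x ↦ (hm x).integrable_of_lipschitzWith hd, ?_⟩)
  simpa using hμ.integrable_of_lipschitzWith (lipschitzWith_integral_kernel hm hLip hd)

lemma IsProbWithFirstMoment.iterate_bind_kernel (hm : IsRandomWalk m)
    (hLip : ∀ x y, wassersteinOne (m x) (m y) ≤ r * edist x y) {μ : Measure X}
    (hμ : IsProbWithFirstMoment μ) (n : ℕ) :
    IsProbWithFirstMoment ((fun ν : Measure X ↦ ν.bind m)^[n] μ) := by
  induction n with
  | zero => exact hμ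
  | succ n ih =>
    rw [Function.iterate_succ_apply']
    exact ih.bind_kernel hm hLip

/-- After `n` steps the walk contracts differences of Lipschitz integrals by the factor `r ^ n`. -/
lemma abs_integral_iterate_sub_le (hm : IsRandomWalk m)
    (hLip : ∀ x y, wassersteinOne (m x) (m y) ≤ r * edist x y) {μ ν : Measure X}
    (hμ : IsProbWithFirstMoment μ) (hν : IsProbWithFirstMoment ν) (x₀ : X) (n : ℕ)
    {L : ℝ≥0} {h : X → ℝ} (hh : LipschitzWith L h) :
    |∫ y, h y ∂(fun ν : Measure X ↦ ν.bind m)^[n] μ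
        - ∫ y, h y ∂(fun ν : Measure X ↦ ν.bind m)^[n] ν|
      ≤ r ^ n * L * (∫ y, dist y x₀ ∂μ + ∫ y, dist y x₀ ∂ν) := by
  induction n generalizing L h with
  | zero =>
    have h1 := hμ.abs_integral_sub_apply_le hh x₀
    have h2 := hν.abs_integral_sub_apply_le hh x₀
    rw [abs_sub_comm] at h2
    simp only [Function.iterate_zero, id_eq, pow_zero, one_mul, mul_add]
    exact (abs_sub_le _ (h x₀) _).trans (add_le_add h1 h2)
  | succ n ih =>
    have hμ' := hμ.iterate_bind_kernel hm hLip n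
    have hν' := hν.iterate_bind_kernel hm hLip n
    rw [Function.iterate_succ_apply', Function.iterate_succ_apply',
      integral_bind_kernel ((hμ'.bind_kernel hm hLip).integrable_of_lipschitzWith hh),
      integral_bind_kernel ((hν'.bind_kernel hm hLip).integrable_of_lipschitzWith hh)]
    refine (ih (lipschitzWith_integral_kernel hm hLip hh)).trans_eq ?_
    push_cast
    ring

lemma eq_of_invariant (hm : IsRandomWalk m) (hr : r < 1)
    (hLip : ∀ x y, wassersteinOne (m x) (m y) ≤ r * edist x y) {μ ν : Measure X}
    (hμ : IsProbWithFirstMoment μ) (hν : IsProbWithFirstMoment ν)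
    (hmμ : m.Invariant μ) (hmν : m.Invariant ν) : μ = ν := by
  have := hμ.isProbabilityMeasure
  have := hν.isProbabilityMeasure
  obtain ⟨x₀⟩ : Nonempty X := nonempty_of_isProbabilityMeasure μ
  refine ext_of_forall_integral_eq_of_bounded_lipschitzWith fun L h hh _ ↦ ?_
  have hle : ∀ n : ℕ, |∫ y, h y ∂μ - ∫ y, h y ∂ν|
      ≤ r ^ n * (L * (∫ y, dist y x₀ ∂μ + ∫ y, dist y x₀ ∂ν)) := fun n ↦ by
    have key := abs_integral_iterate_sub_le hm hLip hμ hν x₀ n hh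
    rwa [Function.iterate_fixed (f := fun ν : Measure X ↦ ν.bind m) hmμ,
      Function.iterate_fixed (f := fun ν : Measure X ↦ ν.bind m) hmν, mul_assoc] at key
  have hlim := (tendsto_pow_atTop_nhds_zero_of_lt_one r.coe_nonneg (by exact_mod_cast hr)).mul_const
    ((L : ℝ) * (∫ y, dist y x₀ ∂μ + ∫ y, dist y x₀ ∂ν))
  rw [zero_mul] at hlim
  exact sub_eq_zero.1 (abs_nonpos_iff.1 (ge_of_tendsto' hlim hle))

/-- The first moments along the walk started at `x₀` are bounded. -/
lemma exists_integral_dist_iterate_le (hm : IsRandomWalk m) (hr : r < 1)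
    (hLip : ∀ x y, wassersteinOne (m x) (m y) ≤ r * edist x y) (x₀ : X) :
    ∃ M : ℝ, ∀ n : ℕ,
      ∫ y, dist y x₀ ∂(fun ν : Measure X ↦ ν.bind m)^[n] (Measure.dirac x₀) ≤ M := by
  have hd : LipschitzWith 1 fun y ↦ dist y x₀ := LipschitzWith.dist_left x₀
  have hr' : (0 : ℝ) < 1 - r := sub_pos.2 (by exact_mod_cast hr)
  set c := ∫ y, dist y x₀ ∂m x₀
  have hc : 0 ≤ c := integral_nonneg fun _ ↦ dist_nonneg
  refine ⟨c / (1 - r), fun n ↦ ?_⟩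
  induction n with
  | zero => simpa using div_nonneg hc hr'.le
  | succ n ih =>
    have hP := (isProbWithFirstMoment_dirac x₀).iterate_bind_kernel hm hLip n
    rw [Function.iterate_succ_apply',
      integral_bind_kernel ((hP.bind_kernel hm hLip).integrable_of_lipschitzWith hd)]
    have h1 := (abs_le.1
      (hP.abs_integral_sub_apply_le (lipschitzWith_integral_kernel hm hLip hd) x₀)).2
    rw [mul_one] at h1
    have h2 := mul_le_mul_of_nonneg_left ih r.coe_nonneg
    have h3 : c + r * (c / (1 - r)) = c / (1 - r) := by field_simp; ring
    linarith

end Contraction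

section Existence

variable {X : Type*} [MetricSpace X] [MeasurableSpace X] [BorelSpace X]

/-- First moments pass to weak limits. -/
lemma isProbWithFirstMoment_of_tendsto {ι : Type*} {l : Filter ι} [l.NeBot]
    {μ : ι → ProbabilityMeasure X} {υ : ProbabilityMeasure X} (hυ : Tendsto μ l (𝓝 υ))
    {x₀ : X} (hd : ∀ i, Integrable (fun y ↦ dist y x₀) (μ i : Measure X)) {M : ℝ}
    (hM : ∀ i, ∫ y, dist y x₀ ∂(μ i : Measure X) ≤ M) :
    IsProbWithFirstMoment (υ : Measure X) := by
  refine ⟨inferInstance, x₀, lt_of_le_of_lt ?_ (ENNReal.ofReal_lt_top (r := M))⟩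
  have hcont : ∀ k : ℕ, Continuous fun y ↦ min (dist y x₀) k := fun k ↦ by fun_prop
  have hbound : ∀ (k : ℕ) y, ‖min (dist y x₀) (k : ℝ)‖ ≤ k := fun k y ↦ by
    rw [Real.norm_of_nonneg (le_min dist_nonneg k.cast_nonneg)]
    exact min_le_right _ _
  have hint : ∀ (k : ℕ) (ρ : ProbabilityMeasure X),
      Integrable (fun y ↦ min (dist y x₀) (k : ℝ)) (ρ : Measure X) := fun k ρ ↦
    Integrable.of_bound (hcont k).measurable.aestronglyMeasurable k (ae_of_all _ (hbound k))
  have htrunc : ∀ k : ℕ, ∫⁻ y, ENNReal.ofReal (min (dist y x₀) k) ∂(υ : Measure X)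
      ≤ ENNReal.ofReal M := fun k ↦ by
    rw [← ofReal_integral_eq_lintegral_ofReal (hint k υ)
      (ae_of_all _ fun y ↦ le_min dist_nonneg k.cast_nonneg)]
    refine ENNReal.ofReal_le_ofReal (le_of_tendsto'
      (ProbabilityMeasure.tendsto_iff_forall_integral_tendsto.1 hυ
        (BoundedContinuousFunction.ofNormedAddCommGroup _ (hcont k) k (hbound k))) fun i ↦ ?_)
    exact (integral_mono (hint k (μ i)) (hd i) fun y ↦ min_le_left _ _).trans (hM i)
  calc ∫⁻ y, edist y x₀ ∂(υ : Measure X)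
      = ∫⁻ y, liminf (fun k : ℕ ↦ ENNReal.ofReal (min (dist y x₀) k)) atTop ∂(υ : Measure X) := by
        refine lintegral_congr fun y ↦ (Tendsto.liminf_eq (tendsto_const_nhds.congr' ?_)).symm
        filter_upwards [eventually_ge_atTop ⌈dist y x₀⌉₊] with k hk
        rw [min_eq_left ((Nat.le_ceil _).trans (by exact_mod_cast hk)), edist_dist]
    _ ≤ liminf (fun k : ℕ ↦ ∫⁻ y, ENNReal.ofReal (min (dist y x₀) k) ∂(υ : Measure X)) atTop :=
        lintegral_liminf_le fun k ↦ (hcont k).measurable.ennreal_ofReal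
    _ ≤ ENNReal.ofReal M :=
        liminf_le_of_frequently_le' (Frequently.of_forall htrunc)

variable [CompleteSpace X] [SecondCountableTopology X] {m : Kernel X X} {r : ℝ≥0}

lemma exists_invariant [Nonempty X] (hm : IsRandomWalk m) (hr : r < 1)
    (hLip : ∀ x y, wassersteinOne (m x) (m y) ≤ r * edist x y) :
    ∃ υ : Measure X, IsProbWithFirstMoment υ ∧ m.Invariant υ := by
  obtain ⟨x₀⟩ := ‹Nonempty X›
  have := hm.isMarkovKernel
  have hr' : (r : ℝ) < 1 := by exact_mod_cast hr
  obtain ⟨M, hM⟩ := exists_integral_dist_iterate_le hm hr hLip x₀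
  have hM0 : 0 ≤ M := (integral_nonneg fun _ ↦ dist_nonneg).trans (hM 0)
  have hP := (isProbWithFirstMoment_dirac x₀).iterate_bind_kernel hm hLip
  set T : Measure X → Measure X := fun ν ↦ ν.bind m with hT
  have hprob : ∀ n, IsProbabilityMeasure (T^[n] (Measure.dirac x₀)) :=
    fun n ↦ (hP n).isProbabilityMeasure
  have hdiff : ∀ (N k : ℕ) (L : ℝ≥0) (h : X → ℝ), LipschitzWith L h →
      |∫ y, h y ∂T^[N + k] (Measure.dirac x₀) - ∫ y, h y ∂T^[N] (Measure.dirac x₀)|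
        ≤ r ^ N * (L * (M + M)) := fun N k L h hh ↦ by
    have key := abs_integral_iterate_sub_le hm hLip (hP k) (hP 0) x₀ N hh
    rw [← hT, ← Function.iterate_add_apply, ← Function.iterate_add_apply, add_zero,
      mul_assoc] at key
    refine key.trans ?_
    gcongr
    exacts [hM k, hM 0]
  have hzero : ∀ L : ℝ≥0, Tendsto (fun N : ℕ ↦ (r : ℝ) ^ N * (L * (M + M))) atTop (𝓝 0) :=
    fun L ↦ by
      simpa using (tendsto_pow_atTop_nhds_zero_of_lt_one r.coe_nonneg hr').mul_const (L * (M + M))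
  have htight : IsTightMeasureSet (Set.range fun n ↦ T^[n] (Measure.dirac x₀)) := by
    refine isTightMeasureSet_range_of_cauchy _ fun L ε hε ↦ ?_
    obtain ⟨N, hN⟩ := ((hzero L).eventually (gt_mem_nhds hε)).exists
    refine ⟨N, fun n hn h hh ↦ ?_⟩
    obtain ⟨k, rfl⟩ := Nat.exists_eq_add_of_le hn
    exact (hdiff N k L h hh).trans hN.le
  let P : ℕ → ProbabilityMeasure X := fun n ↦ ⟨T^[n] (Measure.dirac x₀), hprob n⟩
  have hcomp : IsCompact (closure (Set.range P)) := by
    refine isCompact_closure_of_isTightMeasureSet (htight.subset ?_)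
    rintro _ ⟨_, ⟨n, rfl⟩, rfl⟩
    exact ⟨n, rfl⟩
  obtain ⟨υ, -, hυ⟩ := hcomp.ultrafilter_le_nhds ((hyperfilter ℕ).map P)
    (le_principal_iff.2 (Filter.mem_map.2 (Filter.univ_mem' fun n ↦ subset_closure ⟨n, rfl⟩)))
  have hυ' : Tendsto P (hyperfilter ℕ) (𝓝 υ) := hυ
  refine ⟨υ, isProbWithFirstMoment_of_tendsto hυ'
    (fun n ↦ (hP n).integrable_of_lipschitzWith (LipschitzWith.dist_left x₀)) hM, ?_⟩
  refine ext_of_forall_integral_eq_of_bounded_lipschitzWith fun L h hh hb ↦ ?_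
  have hbi : ∀ ρ : Measure X, IsProbabilityMeasure ρ → Integrable h ρ := fun ρ _ ↦
    Integrable.of_bound hh.continuous.measurable.aestronglyMeasurable 1 (ae_of_all _ hb)
  have hmh := lipschitzWith_integral_kernel hm hLip hh
  have hmb : ∀ x, ‖∫ y, h y ∂m x‖ ≤ 1 := fun x ↦ by
    simpa using norm_integral_le_of_norm_le_const (ae_of_all (m x) hb)
  have lim := ProbabilityMeasure.tendsto_iff_forall_integral_tendsto.1 hυ'
  have lim1 : Tendsto (fun n ↦ ∫ y, h y ∂T^[n] (Measure.dirac x₀)) (hyperfilter ℕ)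
      (𝓝 (∫ y, h y ∂(υ : Measure X))) :=
    lim (BoundedContinuousFunction.ofNormedAddCommGroup h hh.continuous 1 hb)
  have lim2 : Tendsto (fun n ↦ ∫ y, h y ∂T^[n + 1] (Measure.dirac x₀)) (hyperfilter ℕ)
      (𝓝 (∫ y, h y ∂(υ : Measure X).bind m)) := by
    rw [integral_bind_kernel (hbi _ inferInstance)]
    refine (lim (BoundedContinuousFunction.ofNormedAddCommGroup _ hmh.continuous 1 hmb)).congr
      fun n ↦ ?_
    rw [Function.iterate_succ_apply']
    exact (integral_bind_kernel (hbi _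
      ((hP n).bind_kernel hm hLip).isProbabilityMeasure)).symm
  have lim3 : Tendsto (fun n ↦ ∫ y, h y ∂T^[n + 1] (Measure.dirac x₀)
      - ∫ y, h y ∂T^[n] (Measure.dirac x₀)) (hyperfilter ℕ) (𝓝 0) :=
    (squeeze_zero_norm (fun n ↦ hdiff n 1 L h hh) (hzero L)).mono_left Nat.hyperfilter_le_atTop
  exact sub_eq_zero.1 (tendsto_nhds_unique (lim2.sub lim1) lim3)

end Existence

theorem mainTheorem10 {H : Type*} [NormedAddCommGroup H] [InnerProductSpace ℝ H] [CompleteSpace H]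
    [TopologicalSpace.SeparableSpace H] [MeasurableSpace H] [BorelSpace H]
    (m : Kernel H H) (hm : IsRandomWalk m)
    (τ : ℝ) (hτ : τ < 1)
    (hLip : ∀ x y : H, wassersteinOne (m x) (m y) ≤ ENNReal.ofReal (τ * ‖x - y‖)) :
    ∃! υ : Measure H, IsProbWithFirstMoment υ ∧ m.Invariant υ := by

  have := UniformSpace.secondCountable_of_separable H
  have hr : τ.toNNReal < 1 := by simpa using hτ
  have hLip' : ∀ x y : H, wassersteinOne (m x) (m y) ≤ τ.toNNReal * edist x y := fun x y ↦ by
    refine (hLip x y).trans_eq ?_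
    rw [ENNReal.ofReal_mul' (norm_nonneg _), edist_dist, dist_eq_norm]
    rfl
  obtain ⟨υ, hυ, hinv⟩ := exists_invariant hm hr hLip'
  exact ⟨υ, ⟨hυ, hinv⟩, fun ν hν ↦ eq_of_invariant hm hr hLip' hν.1 hυ hν.2 hinv⟩
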